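/- **Setting.** Let $T\ge 2$ and let $\mathcal S_1,\dots,\mathcal S_T$ be discrete state spaces, $\mathcal S_{1:t}=\mathcal S_1\times\dots\times\mathcal S_t$. Fix a prompt $s_0$. Let $\pi_{\rm ref}(\cdot\mid s_0,s_{1:t})$ be an autoregressive base model (a probability mass function on $\mathcal S_{t+1}$ for each prefix $s_{1:t}$), and let $\hat V(s_0,s_{1:t})>0$, $0\le t\le T$, be a reward model on prefixes ($s_{1:0}=\varnothing$; the usual normalization is $\hat V(s_0,\varnothing)=1$). The target is $\tilde\pi_T(s_{1:T})\propto \pi_{\rm ref}(s_{1:T}\mid s_0)\,\hat V(s_0,s_{1:T})$. Assume that for some $L>0$ and some $\varepsilon_g$: 1. (ratio bound) for all $1\le t\le T$ and all $s_{1:t}$, $$\max\Big\{\tfrac{\hat V(s_0,s_{1:t-1})}{\hat V(s_0,s_{1:t})},\tfrac{\hat V(s_0,s_{1:t})}{\hat V(s_0,s_{1:t-1})}\Big\}\le L;$$ 2. (global Bellman error bound) for all $1\le t\le T$ and all $s_{1:t}$, $$\max\Big\{\tfrac{\hat V(s_0,s_{1:t})}{\mathbb E_{\pi_{\rm ref}}[\hat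 V(s_0,s_{1:T})\mid s_{1:t}]},\tfrac{\mathbb E_{\pi_{\rm ref}}[\hat V(s_0,s_{1:T})\mid s_{1:t}]}{\hat V(s_0,s_{1:t})}\Big\}\le 1+\varepsilon_g .$$ **Naive-proposal SMC.** Let $M_{t}$ be the kernel that appends $s_{t}\sim\pi_{\rm ref}(\cdot\mid s_0,s_{1:t-1})$ to $s_{1:t-1}$, and $G_t(s_{1:t})=\hat V(s_0,s_{1:t})/\hat V(s_0,s_{1:t-1})$. The Feynman–Kac flow is $\eta_1=\pi_{\rm ref}(\cdot\mid s_0)$, $\eta_{t+1}=\Phi_{t+1}(\eta_t)$, where $\Phi_{t+1}(\eta)$ reweights $\eta$ by $G_t$, normalizes, and applies $M_{t+1}$, with $M_{T+1}=\mathrm{Id}$. An SMC sampler with $N\ge 1$ particles draws $X_1^1,\dots,X_1^N$ i.i.d. from $\eta_1$ and then, given the particles at time $t$ with empirical measure $\eta_t^N$, draws $X_{t+1}^i\sim K_{t+1,\eta_t^N}(X_t^i,\cdot)$ independently, $t=1,\dots,T$, where the $K_{t+1,\eta}$ are any Markov kernels with $\eta K_{t+1,\eta}=\Phi_{t+1}(\eta)$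 for all $\eta$. Its output law is $\bar\eta^N_{T+1}=\mathbb E[\eta^N_{T+1}]$. The naive-proposal SMC algorithm uses $K_{t+1,\eta}(x,\cdot)=\Phi_{t+1}(\eta)$: in each step it weights the particles by $G_t$, resamples $N$ i.i.d. ancestors from the normalized weights and extends them by $\pi_{\rm ref}$; after a terminal weighting and resampling step it outputs a uniformly chosen particle. Its running time is counted in elementary operations: base-model draws, reward-model evaluations, arithmetic operations, extending or copying a particle, and random index draws, where resampling $N$ indices from $N$ weights costs $O(N)$. **Claim.** $\eta_{T+1}=\tilde\pi_T$, and for every $\delta_{\rm TV}\in(0,1)$ the following hold. * *Particles.* If $$N\ \ge\ \frac{L^6\,T\,(1+\varepsilon_g)^6}{2\,\delta_{\rm TV}},$$ then $\|\bar\eta^N_{T+1}-\tilde\pi_T\|_{\rm TV}\le\delta_{\rm TV}$ for every such SMC sampler, in particular for the naive-proposal SMC algorithm. * *Time.* There is a number of particles $N$ satisfying this bound for which the naive-proposal SMC algorithm, with total variation error at most $\delta_{\rm TV}$, always runs in time at most $$C\,\frac{L^6(1+\varepsilon_g)^6\,T^2}{\delta_{\rm TV}},$$ where $C$ is a universal constant.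 -/

import Mathlib

open scoped NNReal ENNReal

noncomputable section

namespace SMC

universe u v

/-! ## Discrete probability -/

/-- The probability mass function proportional to `f`. The second argument is a fallback, used only
if `f` has total mass `0` or `∞`. -/
def normalizeOr {α : Type u} (f : α → ℝ≥0∞) (fallback : PMF α) : PMF α :=
  open Classical in
  if h : (∑' a, f a) ≠ 0 ∧ (∑' a, f a) ≠ ∞ then PMF.normalize f h.1 h.2 else fallback

/-- The law `μ` reweighted by the nonnegative function `g`, i.e. the law proportional to `μ * g`. -/
def reweight {α : Type u} (μ : PMF α) (g : α → ℝ≥0) : PMF α :=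
  normalizeOr (fun a => μ a * (g a : ℝ≥0∞)) μ

/-- Expectation of a real function. -/
def expect {α : Type u} (μ : PMF α) (f : α → ℝ) : ℝ :=
  ∑' a, (μ a).toReal * f a

/-- Total variation distance: the supremum over all events of the difference of the
probabilities. -/
def tvDist {α : Type u} (μ ν : PMF α) : ℝ :=
  ⨆ A : Set α, |(μ.toOuterMeasure A).toReal - (ν.toOuterMeasure A).toReal|

/-- The law of independent random variables `X 0, …, X (N - 1)` with `X i` of law `p i`. -/
def indep {α : Type u} : {N : ℕ} → (Fin N → PMF α) → PMF (Fin N → α)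
  | 0, _ => PMF.pure Fin.elim0
  | _ + 1, p => (p 0).bind fun a => (indep fun i => p i.succ).map fun x => Fin.cons a x

/-- The empirical measure `(1 / N) ∑ i, δ_{x i}` of a nonempty particle configuration. -/
def empirical {α : Type u} {N : ℕ} [NeZero N] (x : Fin N → α) : PMF α :=
  (PMF.uniformOfFintype (Fin N)).map x

/-- The categorical law on `Fin N` with probabilities proportional to the weights `w`
(uniform if all weights vanish). -/
def categorical {N : ℕ} [NeZero N] (w : Fin N → ℝ≥0) : PMF (Fin N) :=
  normalizeOr (fun i => (w i : ℝ≥0∞)) (PMF.uniformOfFintype (Fin N))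

/-! ## Reasoning trajectories, base model and reward model

`S 0` is the prompt space and `S t`, `t ≥ 1`, is the state space (tokens or sentences) of the
`t`-th reasoning step. In this section the prompt is fixed: `π t x` is the law of the next state
`s_{t+1}` given the prefix `x = s_{1:t}`, and `V t x` is the value `V(s_0, s_{1:t})` of the
reward model. -/

/-- The space `S_{1:t}` of prefixes of length `t`. -/
def Prefix (S : ℕ → Type u) : ℕ → Type u
  | 0 => PUnit
  | t + 1 => Prefix S t × S (t + 1)

section Model

variable {S : ℕ → Type u}

/-- The empty prefix. -/
def Prefix.nil : Prefix S 0 := PUnit.unit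

/-- Append a state to a prefix. -/
def Prefix.snoc {t : ℕ} (x : Prefix S t) (s : S (t + 1)) : Prefix S (t + 1) := (x, s)

/-- Drop the last state: `s_{1:t+1} ↦ s_{1:t}`. -/
def Prefix.init {t : ℕ} (x : Prefix S (t + 1)) : Prefix S t := Prod.fst x

/-- The naive proposal kernel `M_{t+1}` from `S_{1:t}` to `S_{1:t+1}`: keep the prefix and append a
state drawn from the base model. -/
def naiveKernel (π : ∀ t, Prefix S t → PMF (S (t + 1))) (t : ℕ) (x : Prefix S t) :
    PMF (Prefix S (t + 1)) :=
  (π t x).map x.snoc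

/-- The law of the trajectory `s_{1:T}` under the base model, given its prefix `s_{1:t} = x`. -/
def rollout (π : ∀ t, Prefix S t → PMF (S (t + 1))) {t T : ℕ} (h : t ≤ T) (x : Prefix S t) :
    PMF (Prefix S T) :=
  Nat.leRecOn (C := fun k => PMF (Prefix S k)) h (fun {k} μ => μ.bind (naiveKernel π k))
    (PMF.pure x)

/-- The reward-tilted target law on trajectories, proportional to `π(s_{1:T}) V(s_{1:T})`. -/
def target (π : ∀ t, Prefix S t → PMF (S (t + 1))) (V : ∀ t, Prefix S t → ℝ≥0) (T : ℕ) :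
    PMF (Prefix S T) :=
  reweight (rollout π (Nat.zero_le T) Prefix.nil) (V T)

/-- Reward model ratio bound with constant `L`. -/
def RatioBound (V : ∀ t, Prefix S t → ℝ≥0) (T : ℕ) (L : ℝ) : Prop :=
  ∀ t < T, ∀ x : Prefix S (t + 1),
    max ((V t x.init : ℝ) / V (t + 1) x) ((V (t + 1) x : ℝ) / V t x.init) ≤ L

/-- Global Bellman error bound with constant `ε`. -/
def GlobalBellmanBound (π : ∀ t, Prefix S t → PMF (S (t + 1))) (V : ∀ t, Prefix S t → ℝ≥0)
    (T : ℕ) (ε : ℝ) : Prop :=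
  ∀ t, 1 ≤ t → ∀ (h : t ≤ T) (x : Prefix S t),
    max ((V t x : ℝ) / expect (rollout π h x) (fun y => (V T y : ℝ)))
      (expect (rollout π h x) (fun y => (V T y : ℝ)) / (V t x : ℝ)) ≤ 1 + ε

/-! ## The Feynman–Kac flow and the SMC sampler (naive proposal) -/

/-- The potentials (incremental weights) of the naive proposal:
`G_t(s_{1:t}) = V(s_0, s_{1:t}) / V(s_0, s_{1:t-1})` for `t ≥ 1`, and `G_0 = 1`. -/
def potential (V : ∀ t, Prefix S t → ℝ≥0) : ∀ t, Prefix S t → ℝ≥0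
  | 0, _ => 1
  | t + 1, x => V (t + 1) x / V t x.init

/-- The normalized Feynman–Kac map `Φ_{t+1}`: reweight by `G_t`, then propagate by `M_{t+1}`. -/
def fkMap (π : ∀ t, Prefix S t → PMF (S (t + 1))) (V : ∀ t, Prefix S t → ℝ≥0) (t : ℕ)
    (η : PMF (Prefix S t)) : PMF (Prefix S (t + 1)) :=
  (reweight η (potential V t)).bind (naiveKernel π t)

/-- The Feynman–Kac flow `η_t`, started from the empty prefix, so `η_1 = π(· | s_0)`. -/
def fkFlow (π : ∀ t, Prefix S t → PMF (S (t + 1))) (V : ∀ t, Prefix S t → ℝ≥0) :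
    ∀ t, PMF (Prefix S t)
  | 0 => PMF.pure Prefix.nil
  | t + 1 => fkMap π V t (fkFlow π V t)

/-- The terminal Feynman–Kac map `Φ_{T+1}`: reweight by `G_T`, then apply `M_{T+1} = Id`. -/
def fkTerminalMap (V : ∀ t, Prefix S t → ℝ≥0) (T : ℕ) (η : PMF (Prefix S T)) :
    PMF (Prefix S T) :=
  reweight η (potential V T)

/-- The terminal law `η_{T+1}` of the Feynman–Kac flow. -/
def fkTerminal (π : ∀ t, Prefix S t → PMF (S (t + 1))) (V : ∀ t, Prefix S t → ℝ≥0) (T : ℕ) :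
    PMF (Prefix S T) :=
  fkTerminalMap V T (fkFlow π V T)

/-- `K` (for the steps `1, …, T`) and `K'` (for the terminal step `T + 1`) are McKean kernels of the
Feynman–Kac flow: `η K_{p+1,η} = Φ_{p+1}(η)` for every law `η`. -/
def IsMcKean (π : ∀ t, Prefix S t → PMF (S (t + 1))) (V : ∀ t, Prefix S t → ℝ≥0) (T : ℕ)
    (K : ∀ t, PMF (Prefix S t) → Prefix S t → PMF (Prefix S (t + 1)))
    (K' : PMF (Prefix S T) → Prefix S T → PMF (Prefix S T)) : Prop :=
  (∀ t < T, ∀ η, η.bind (K t η) = fkMap π V t η) ∧ ∀ η, η.bind (K' η) = fkTerminalMap V T η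

/-- The joint law of the `N` particles at time `t`. Given the particles at time `t`, with empirical
measure `η`, the next ones are drawn independently, the `i`-th one from `K_{t+1,η}(X_t^i, ·)`. All
particles start from the empty prefix at time `0`, so McKean kernels yield `N` independent samples
of `η_1` at time `1`. -/
def particleLaw (K : ∀ t, PMF (Prefix S t) → Prefix S t → PMF (Prefix S (t + 1)))
    (N : ℕ) [NeZero N] : ∀ t, PMF (Fin N → Prefix S t)
  | 0 => PMF.pure fun _ => Prefix.nil
  | t + 1 => (particleLaw K N t).bind fun x => indep fun i => K t (empirical x) (x i)

/-- The output law `E[η_{T+1}^N]` of the SMC sampler: the mean of the empirical measure of the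
particles after the terminal step. -/
def outputLaw {T : ℕ} (K : ∀ t, PMF (Prefix S t) → Prefix S t → PMF (Prefix S (t + 1)))
    (K' : PMF (Prefix S T) → Prefix S T → PMF (Prefix S T)) (N : ℕ) [NeZero N] :
    PMF (Prefix S T) :=
  ((particleLaw K N T).bind fun x => indep fun i => K' (empirical x) (x i)).bind empirical

end Model

/-! ## Randomized computations with a step count -/

/-- A randomized computation: the joint law of its result and of the number of elementary
operations that it performs. -/
def Timed (α : Type u) : Type u := PMF (α × ℕ)

/-- Return a value at no cost. -/
def Timed.ret {α : Type u} (a : α) : Timed α := PMF.pure (a, 0)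

/-- Run `x`, then run `f` on its result with fresh randomness. The step counts add up. -/
def Timed.bind {α : Type u} {β : Type v} (x : Timed α) (f : α → Timed β) : Timed β :=
  PMF.bind x fun p => PMF.map (fun q : β × ℕ => (q.1, p.2 + q.2)) (f p.1)

/-- A deterministic computation of `a` with `k` elementary operations. -/
def Timed.calc {α : Type u} (k : ℕ) (a : α) : Timed α := PMF.pure (a, k)

/-- One random draw from `p`, as one elementary operation. -/
def Timed.draw {α : Type u} (p : PMF α) : Timed α := PMF.map (fun a => (a, 1)) p

/-- A loop that runs `c 0, …, c (N - 1)` one after the other and collects the results. -/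
def Timed.forEach {α : Type u} : {N : ℕ} → (Fin N → Timed α) → Timed (Fin N → α)
  | 0, _ => Timed.ret Fin.elim0
  | _ + 1, c => (c 0).bind fun a => (Timed.forEach fun i => c i.succ).bind fun x =>
      Timed.ret (Fin.cons a x)

/-- The law of the result. -/
def Timed.output {α : Type u} (x : Timed α) : PMF α := PMF.map Prod.fst x

/-- No run performs more than `B` elementary operations. -/
def Timed.RunsWithin {α : Type u} (x : Timed α) (B : ℝ) : Prop :=
  ∀ p ∈ PMF.support x, (p.2 : ℝ) ≤ B

/-! ## The naive-proposal SMC algorithm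

Elementary operations, at unit cost: a draw of the next state from the base model, an evaluation of
the reward model, an arithmetic operation, appending a state to a prefix or copying a reference to a
prefix, a uniform draw from the particle indices, and a draw from a categorical law whose sampling
table has been set up. -/

section Algorithm

variable {S : ℕ → Type u}

/-- The incremental weight of a particle: two evaluations of the reward model and a division. (At
time `0` there is nothing to weight.) -/
def weightStep (V : ∀ t, Prefix S t → ℝ≥0) : ∀ t, Prefix S t → Timed ℝ≥0
  | 0, _ => Timed.ret 1
  | t + 1, x => (Timed.calc 1 (V (t + 1) x)).bind fun a =>
      (Timed.calc 1 (V t x.init)).bind fun b => Timed.calc 1 (a / b)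

/-- Draw `N` independent ancestor indices from the categorical law of the weights: `N` operations
each to sum up the weights, to normalize them and to set up the sampling table, then one operation
for each draw. -/
def resample {N : ℕ} [NeZero N] (w : Fin N → ℝ≥0) : Timed (Fin N → Fin N) :=
  (Timed.calc (3 * N) (categorical w)).bind fun p => Timed.forEach fun _ => Timed.draw p

/-- Draw the next state from the base model and append it. -/
def extend (π : ∀ t, Prefix S t → PMF (S (t + 1))) (t : ℕ) (x : Prefix S t) :
    Timed (Prefix S (t + 1)) :=
  (Timed.draw (π t x)).bind fun s => Timed.calc 1 (x.snoc s)

/-- One round: weight and resample the particles (except at time `0`), then propagate them. -/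
def smcRound (π : ∀ t, Prefix S t → PMF (S (t + 1))) (V : ∀ t, Prefix S t → ℝ≥0) {N : ℕ}
    [NeZero N] : ∀ t, (Fin N → Prefix S t) → Timed (Fin N → Prefix S (t + 1))
  | 0, x => Timed.forEach fun i => extend π 0 (x i)
  | t + 1, x => (Timed.forEach fun j => weightStep V (t + 1) (x j)).bind fun w =>
      (resample w).bind fun A => Timed.forEach fun i => extend π (t + 1) (x (A i))

/-- The particles after `t` rounds. -/
def smcRounds (π : ∀ t, Prefix S t → PMF (S (t + 1))) (V : ∀ t, Prefix S t → ℝ≥0) (N : ℕ)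
    [NeZero N] : ∀ t, Timed (Fin N → Prefix S t)
  | 0 => Timed.ret fun _ => Prefix.nil
  | t + 1 => (smcRounds π V N t).bind (smcRound π V t)

/-- The naive-proposal SMC algorithm: `T` rounds, the terminal weighting and resampling step, and
the output of a uniformly chosen particle. -/
def naiveSMC (π : ∀ t, Prefix S t → PMF (S (t + 1))) (V : ∀ t, Prefix S t → ℝ≥0) (T N : ℕ)
    [NeZero N] : Timed (Prefix S T) :=
  (smcRounds π V N T).bind fun x =>
    (Timed.forEach fun j => weightStep V T (x j)).bind fun w =>
      (resample w).bind fun A =>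
        (Timed.forEach fun i => Timed.calc 1 (x (A i))).bind fun y =>
          (Timed.draw (PMF.uniformOfFintype (Fin N))).bind fun I => Timed.ret (y I)

end Algorithm

end SMC

end

/-!
The normalized Feynman–Kac maps preserve the terminal mean `η (Q f) / η (Q 1)`, where `Q` is the
unnormalized Feynman–Kac semigroup up to the terminal time. For the flow itself this mean is the
integral of `f` against the target, so the bias of the particle system telescopes into the biases of
its single steps. In one step the terminal mean of the empirical measure is a self-normalized ratio
of two averages of independent samples; expanding `1 / average` to first order removes the linear
term, and the variances of numerator and denominator bound the rest by `hi / lo / (2 N)` whenever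
`Q 1` takes values in `[lo, hi]`. The function `Q 1` is the product of a one-step value ratio and a
Bellman ratio, hence lies between `(L (1 + ε))⁻¹` and `L (1 + ε)`; the total bias is at most
`T (L (1 + ε))² / (2 N)`.
-/

namespace SMC

noncomputable section

universe u v

/-! ## Expectations of bounded functions -/

/-- Boundedness of a real function on a discrete space, the condition under which the series
`expect μ f` converges for every `μ`. -/
@[fun_prop]
def IsBdd {α : Type u} (f : α → ℝ) : Prop := ∃ C, ∀ a, |f a| ≤ C

namespace IsBdd

variable {α : Type u} {β : Type v} {f g : α → ℝ}

theorem of_mem_Icc {a b : ℝ} (h : ∀ x, f x ∈ Set.Icc a b) : IsBdd f :=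
  ⟨max |a| |b|, fun x => abs_le_max_abs_abs (h x).1 (h x).2⟩

@[fun_prop]
theorem const (c : ℝ) : IsBdd fun _ : α => c := ⟨|c|, fun _ => le_rfl⟩

@[fun_prop]
theorem comp (hf : IsBdd f) (k : β → α) : IsBdd fun b => f (k b) :=
  hf.imp fun _ hC b => hC (k b)

@[fun_prop]
theorem add (hf : IsBdd f) (hg : IsBdd g) : IsBdd fun a => f a + g a := by
  obtain ⟨C, hC⟩ := hf
  obtain ⟨D, hD⟩ := hg
  exact ⟨C + D, fun a => (abs_add_le _ _).trans (add_le_add (hC a) (hD a))⟩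

@[fun_prop]
theorem mul (hf : IsBdd f) (hg : IsBdd g) : IsBdd fun a => f a * g a := by
  obtain ⟨C, hC⟩ := hf
  obtain ⟨D, hD⟩ := hg
  refine ⟨C * D, fun a => ?_⟩
  rw [abs_mul]
  exact mul_le_mul (hC a) (hD a) (abs_nonneg _) ((abs_nonneg _).trans (hC a))

@[fun_prop]
theorem sub (hf : IsBdd f) (hg : IsBdd g) : IsBdd fun a => f a - g a := by
  simpa [sub_eq_add_neg] using hf.add ((const (-1)).mul hg)

@[fun_prop]
theorem sq (hf : IsBdd f) : IsBdd fun a => f a ^ 2 := by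
  simpa [pow_two] using hf.mul hf

theorem div {c : ℝ} (hf : IsBdd f) (hc : 0 < c) (hg : ∀ a, c ≤ g a) :
    IsBdd fun a => f a / g a := by
  obtain ⟨C, hC⟩ := hf
  refine ⟨C / c, fun a => ?_⟩
  rw [abs_div, abs_of_pos (hc.trans_le (hg a))]
  exact div_le_div₀ ((abs_nonneg _).trans (hC a)) (hC a) hc (hg a)

@[fun_prop]
theorem div_const (hf : IsBdd f) (c : ℝ) : IsBdd fun a => f a / c := by
  simpa only [div_eq_mul_inv] using hf.mul (const c⁻¹)

@[fun_prop]
theorem sum {ι : Type v} {s : Finset ι} {F : ι → α → ℝ} (h : ∀ i, IsBdd (F i)) :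
    IsBdd fun a => ∑ i ∈ s, F i a := by
  choose C hC using h
  exact ⟨∑ i ∈ s, C i, fun a =>
    (Finset.abs_sum_le_sum_abs _ _).trans (Finset.sum_le_sum fun i _ => hC i a)⟩

end IsBdd

section Expect

variable {α : Type u} {β : Type v} {μ ν : PMF α} {f g : α → ℝ}

theorem expect_congr (h : ∀ a ∈ μ.support, f a = g a) : expect μ f = expect μ g := by
  refine tsum_congr fun a => ?_
  by_cases ha : a ∈ μ.support
  · rw [h a ha]
  · simp [(μ.apply_eq_zero_iff a).2 ha]

variable (μ)

theorem summable_expect (hf : IsBdd f) : Summable fun a => (μ a).toReal * f a := by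
  obtain ⟨C, hC⟩ := hf
  have hμ : Summable fun a => (μ a).toReal := ENNReal.summable_toReal μ.tsum_coe_ne_top
  refine Summable.of_norm_bounded (hμ.mul_right C) fun a => ?_
  rw [norm_mul, Real.norm_of_nonneg ENNReal.toReal_nonneg]
  exact mul_le_mul_of_nonneg_left (hC a) ENNReal.toReal_nonneg

theorem expect_const (c : ℝ) : expect μ (fun _ => c) = c := by
  unfold expect
  rw [tsum_mul_right, ← ENNReal.tsum_toReal_eq μ.apply_ne_top, μ.tsum_coe, ENNReal.toReal_one,
    one_mul]

theorem expect_pure (a : α) (f : α → ℝ) : expect (PMF.pure a) f = f a := by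
  rw [expect_congr (g := fun _ => f a) (by simp), expect_const]

theorem expect_mul_left (c : ℝ) (f : α → ℝ) : expect μ (fun a => c * f a) = c * expect μ f := by
  unfold expect
  rw [← tsum_mul_left]
  exact tsum_congr fun a => mul_left_comm _ _ _

theorem expect_mul_right (f : α → ℝ) (c : ℝ) : expect μ (fun a => f a * c) = expect μ f * c := by
  simp only [mul_comm _ c, expect_mul_left]

theorem expect_div (f : α → ℝ) (c : ℝ) : expect μ (fun a => f a / c) = expect μ f / c := by
  simp only [div_eq_inv_mul, expect_mul_left]

theorem expect_neg (f : α → ℝ) : expect μ (fun a => -f a) = -expect μ f := by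
  simpa using expect_mul_left μ (-1) f

theorem expect_add (hf : IsBdd f) (hg : IsBdd g) :
    expect μ (fun a => f a + g a) = expect μ f + expect μ g := by
  unfold expect
  rw [← (summable_expect μ hf).tsum_add (summable_expect μ hg)]
  simp only [mul_add]

theorem expect_sub (hf : IsBdd f) (hg : IsBdd g) :
    expect μ (fun a => f a - g a) = expect μ f - expect μ g := by
  unfold expect
  rw [← (summable_expect μ hf).tsum_sub (summable_expect μ hg)]
  simp only [mul_sub]

theorem expect_mono (hf : IsBdd f) (hg : IsBdd g) (h : ∀ a, f a ≤ g a) :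
    expect μ f ≤ expect μ g :=
  (summable_expect μ hf).tsum_le_tsum
    (fun a => mul_le_mul_of_nonneg_left (h a) ENNReal.toReal_nonneg) (summable_expect μ hg)

theorem expect_pos (hf : IsBdd f) (h : ∀ a, 0 < f a) : 0 < expect μ f := by
  obtain ⟨a, ha⟩ := μ.support_nonempty
  refine (summable_expect μ hf).tsum_pos
    (fun b => mul_nonneg ENNReal.toReal_nonneg (h b).le) a (mul_pos ?_ (h a))
  exact ENNReal.toReal_pos ((μ.mem_support_iff a).1 ha) (μ.apply_ne_top a)

theorem expect_mem_Icc {a b : ℝ} (h : ∀ x, f x ∈ Set.Icc a b) : expect μ f ∈ Set.Icc a b := by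
  have hf : IsBdd f := .of_mem_Icc h
  constructor
  · simpa only [expect_const] using expect_mono μ (.const a) hf fun x => (h x).1
  · simpa only [expect_const] using expect_mono μ hf (.const b) fun x => (h x).2

theorem expect_sq_le {b : ℝ} (h : ∀ a, f a ∈ Set.Icc 0 b) :
    expect μ (fun a => f a ^ 2) ≤ b * expect μ f := by
  have hf : IsBdd f := .of_mem_Icc h
  rw [← expect_mul_left]
  refine expect_mono μ (by fun_prop) (by fun_prop) fun a => ?_
  rw [pow_two]
  exact mul_le_mul_of_nonneg_right (h a).2 (h a).1

theorem expect_div_expect_mem_Icc (hg : IsBdd g) (hg_pos : ∀ a, 0 < g a)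
    (h : ∀ a, f a ∈ Set.Icc 0 (g a)) : expect μ f / expect μ g ∈ Set.Icc 0 1 := by
  have hf : IsBdd f := hg.imp fun C hC a => by
    rw [abs_of_nonneg (h a).1]
    exact (h a).2.trans ((le_abs_self _).trans (hC a))
  have denominator_pos : 0 < expect μ g := expect_pos μ hg hg_pos
  constructor
  · refine div_nonneg ?_ denominator_pos.le
    simpa only [expect_const] using expect_mono μ (.const 0) hf fun a => (h a).1
  · exact (div_le_one denominator_pos).2 (expect_mono μ hf hg fun a => (h a).2)

theorem abs_expect_le_expect (hg : IsBdd g) (h : ∀ a, |f a| ≤ g a) :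
    |expect μ f| ≤ expect μ g := by
  have hf : IsBdd f := hg.imp fun C hC a => (h a).trans ((le_abs_self _).trans (hC a))
  refine abs_le.2 ⟨?_, expect_mono μ hf hg fun a => (le_abs_self _).trans (h a)⟩
  rw [neg_le, ← expect_neg]
  exact expect_mono μ (by simpa using (IsBdd.const (-1)).mul hf) hg
    fun a => (neg_le_abs _).trans (h a)

theorem abs_expect_le {C : ℝ} (h : ∀ a, |f a| ≤ C) : |expect μ f| ≤ C :=
  (abs_expect_le_expect μ (.const C) h).trans_eq (expect_const μ C)

@[fun_prop]
theorem IsBdd.expect {f : β → ℝ} (hf : IsBdd f) (k : α → PMF β) :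
    IsBdd fun a => SMC.expect (k a) f :=
  hf.imp fun _ hC a => abs_expect_le (k a) hC

theorem expect_bind (k : α → PMF β) {f : β → ℝ} (hf : IsBdd f) :
    expect (μ.bind k) f = expect μ fun a => expect (k a) f := by
  obtain ⟨C, hC⟩ := hf
  have joint_mass : Summable fun p : α × β => (μ p.1).toReal * (k p.1 p.2).toReal := by
    have : ∑' p : α × β, μ p.1 * k p.1 p.2 ≠ ∞ := by
      rw [ENNReal.tsum_prod' (f := fun p : α × β => μ p.1 * k p.1 p.2)]
      simp [ENNReal.tsum_mul_left, PMF.tsum_coe]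
    simpa [ENNReal.toReal_mul] using ENNReal.summable_toReal this
  have joint : Summable fun p : α × β => (μ p.1).toReal * (k p.1 p.2).toReal * f p.2 := by
    refine Summable.of_norm_bounded (joint_mass.mul_right C) fun p => ?_
    rw [norm_mul, Real.norm_of_nonneg (by positivity)]
    exact mul_le_mul_of_nonneg_left (hC _) (by positivity)
  unfold expect
  calc ∑' b, ((μ.bind k) b).toReal * f b
      = ∑' b, ∑' a, (μ a).toReal * (k a b).toReal * f b := by
        refine tsum_congr fun b => ?_
        rw [PMF.bind_apply, ENNReal.tsum_toReal_eq fun a =>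
          ENNReal.mul_ne_top (μ.apply_ne_top a) ((k a).apply_ne_top b), ← tsum_mul_right]
        simp only [ENNReal.toReal_mul]
    _ = ∑' a, ∑' b, (μ a).toReal * (k a b).toReal * f b :=
        Summable.tsum_comm (f := fun a b => (μ a).toReal * (k a b).toReal * f b) joint
    _ = _ := by simp only [mul_assoc, tsum_mul_left]

theorem expect_map (k : α → β) {f : β → ℝ} (hf : IsBdd f) :
    expect (μ.map k) f = expect μ fun a => f (k a) := by
  rw [← PMF.bind_pure_comp, expect_bind _ _ hf]
  simp only [Function.comp_apply, expect_pure]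

theorem toReal_toOuterMeasure_eq_expect (A : Set α) :
    (μ.toOuterMeasure A).toReal = expect μ (A.indicator 1) := by
  rw [PMF.toOuterMeasure_apply, ENNReal.tsum_toReal_eq]
  · refine tsum_congr fun a => ?_
    by_cases h : a ∈ A <;> simp [h]
  · intro a
    by_cases h : a ∈ A <;> simp [h, μ.apply_ne_top]

theorem indicator_one_mem_Icc (A : Set α) (a : α) :
    A.indicator (1 : α → ℝ) a ∈ Set.Icc 0 1 := by
  by_cases h : a ∈ A <;> simp [h]

variable {μ}

theorem eq_of_forall_expect_eq
    (h : ∀ f : α → ℝ, (∀ a, f a ∈ Set.Icc 0 1) → expect μ f = expect ν f) : μ = ν := by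
  refine PMF.ext fun a => (ENNReal.toReal_eq_toReal_iff' (μ.apply_ne_top a) (ν.apply_ne_top a)).1 ?_
  rw [← PMF.toOuterMeasure_apply_singleton, ← PMF.toOuterMeasure_apply_singleton,
    toReal_toOuterMeasure_eq_expect, toReal_toOuterMeasure_eq_expect]
  exact h _ (indicator_one_mem_Icc {a})

theorem tvDist_le {δ : ℝ}
    (h : ∀ f : α → ℝ, (∀ a, f a ∈ Set.Icc 0 1) → |expect μ f - expect ν f| ≤ δ) :
    tvDist μ ν ≤ δ := by
  refine ciSup_le fun A => ?_
  rw [toReal_toOuterMeasure_eq_expect, toReal_toOuterMeasure_eq_expect]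
  exact h _ (indicator_one_mem_Icc A)

theorem expect_normalizeOr {w : α → ℝ≥0∞} (h0 : ∑' a, w a ≠ 0) (h_top : ∑' a, w a ≠ ∞)
    (f : α → ℝ) :
    expect (normalizeOr w μ) f = (∑' a, (w a).toReal * f a) / ∑' a, (w a).toReal := by
  have : normalizeOr w μ = PMF.normalize w h0 h_top := dif_pos ⟨h0, h_top⟩
  rw [this, ← ENNReal.tsum_toReal_eq (ENNReal.ne_top_of_tsum_ne_top h_top), div_eq_mul_inv,
    ← tsum_mul_right]
  refine tsum_congr fun a => ?_
  rw [PMF.normalize_apply, ENNReal.toReal_mul, ENNReal.toReal_inv]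
  ring

variable (μ)

theorem expect_reweight {w : α → ℝ≥0} (hw : ∀ a, 0 < w a) (hb : IsBdd fun a => (w a : ℝ))
    (f : α → ℝ) :
    expect (reweight μ w) f = expect μ (fun a => w a * f a) / expect μ fun a => (w a : ℝ) := by
  have mass_ne_zero : ∑' a, μ a * (w a : ℝ≥0∞) ≠ 0 := by
    obtain ⟨a, ha⟩ := μ.support_nonempty
    rw [Ne, ENNReal.tsum_eq_zero, not_forall]
    exact ⟨a, mul_ne_zero ((μ.mem_support_iff a).1 ha) (by simpa using (hw a).ne')⟩
  have mass_ne_top : ∑' a, μ a * (w a : ℝ≥0∞) ≠ ∞ := by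
    have h := (summable_expect μ hb).tsum_ofReal_ne_top
    refine ne_of_eq_of_ne (tsum_congr fun a => ?_) h
    rw [ENNReal.ofReal_mul ENNReal.toReal_nonneg, ENNReal.ofReal_toReal (μ.apply_ne_top a),
      ENNReal.ofReal_coe_nnreal]
  rw [reweight, expect_normalizeOr mass_ne_zero mass_ne_top]
  simp only [expect, ENNReal.toReal_mul, ENNReal.coe_toReal, mul_assoc]

end Expect

/-! ## Independent samples and empirical measures -/

/-- The uniform mixture `(1 / N) ∑ i, p i` of the laws `p 0, …, p (N - 1)`. -/
def mixture {α : Type u} {N : ℕ} [NeZero N] (p : Fin N → PMF α) : PMF α :=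
  (PMF.uniformOfFintype (Fin N)).bind p

section Samples

variable {α : Type u} {β : Type v} {N : ℕ}

theorem expect_mixture [NeZero N] (p : Fin N → PMF α) {f : α → ℝ} (hf : IsBdd f) :
    expect (mixture p) f = (∑ i, expect (p i) f) / N := by
  rw [mixture, expect_bind _ _ hf]
  simp [expect, tsum_fintype, Finset.mul_sum, div_eq_inv_mul]

theorem empirical_eq_mixture [NeZero N] (x : Fin N → α) :
    empirical x = mixture fun i => PMF.pure (x i) :=
  (PMF.bind_pure_comp _ _).symm

theorem expect_empirical [NeZero N] (x : Fin N → α) {f : α → ℝ} (hf : IsBdd f) :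
    expect (empirical x) f = (∑ i, f (x i)) / N := by
  simp only [empirical_eq_mixture, expect_mixture _ hf, expect_pure]

theorem empirical_bind [NeZero N] (x : Fin N → α) (k : α → PMF β) :
    (empirical x).bind k = mixture fun i => k (x i) :=
  PMF.bind_map _ _ _

theorem indep_succ (p : Fin (N + 1) → PMF α) :
    indep p = (p 0).bind fun a => (indep fun i => p i.succ).map fun x => Fin.cons a x := rfl

theorem indep_pure : ∀ {N : ℕ} (x : Fin N → α), indep (fun i => PMF.pure (x i)) = PMF.pure x
  | 0, x => congrArg PMF.pure (Subsingleton.elim _ _)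
  | N + 1, x => by
    rw [indep_succ, indep_pure fun i => x i.succ, PMF.pure_bind, PMF.pure_map]
    exact congrArg PMF.pure (Fin.cons_self_tail x)

theorem indep_bind_indep : ∀ {N : ℕ} (p : Fin N → PMF α) (k : Fin N → α → PMF β),
    ((indep p).bind fun x => indep fun i => k i (x i)) = indep fun i => (p i).bind (k i)
  | 0, _, _ => PMF.pure_bind _ _
  | N + 1, p, k => by
    simp only [indep_succ, PMF.bind_bind, PMF.bind_map, Function.comp_def, Fin.cons_zero,
      Fin.cons_succ]
    congr 1
    funext a
    rw [PMF.bind_comm]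
    congr 1
    funext b
    rw [← indep_bind_indep (fun i => p i.succ) fun i => k i.succ, PMF.map_bind]

theorem expect_indep_succ (p : Fin (N + 1) → PMF α) {F : (Fin (N + 1) → α) → ℝ} (hF : IsBdd F) :
    expect (indep p) F
      = expect (p 0) fun a => expect (indep fun i => p i.succ) fun x => F (Fin.cons a x) := by
  rw [indep_succ, expect_bind _ _ hF]
  simp only [expect_map _ _ hF]

theorem expect_indep_sum : ∀ {N : ℕ} (p : Fin N → PMF α) {f : α → ℝ}, IsBdd f →
    expect (indep p) (fun x => ∑ i, f (x i)) = ∑ i, expect (p i) f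
  | 0, _, _, _ => by simp [expect_const]
  | N + 1, p, f, hf => by
    rw [expect_indep_succ _ (by fun_prop)]
    simp (disch := fun_prop) only [Fin.sum_univ_succ, Fin.cons_zero, Fin.cons_succ, expect_add,
      expect_const, expect_indep_sum]

theorem expect_indep_sum_sq : ∀ {N : ℕ} (p : Fin N → PMF α) {f : α → ℝ}, IsBdd f →
    expect (indep p) (fun x => (∑ i, f (x i)) ^ 2)
      = (∑ i, expect (p i) f) ^ 2 + ∑ i, (expect (p i) (fun a => f a ^ 2) - expect (p i) f ^ 2)
  | 0, _, _, _ => by simp [expect_const]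
  | N + 1, p, f, hf => by
    rw [expect_indep_succ _ (by fun_prop)]
    simp (disch := fun_prop) only [Fin.sum_univ_succ, Fin.cons_zero, Fin.cons_succ, add_sq,
      expect_add, expect_const, expect_mul_left, expect_mul_right, expect_indep_sum,
      expect_indep_sum_sq]
    ring

theorem expect_indep_empirical [NeZero N] (p : Fin N → PMF α) {f : α → ℝ} (hf : IsBdd f) :
    expect (indep p) (fun x => expect (empirical x) f) = expect (mixture p) f := by
  simp only [expect_empirical _ hf, expect_div, expect_indep_sum _ hf, expect_mixture _ hf]

theorem expect_indep_empirical_sub_sq_le [NeZero N] (p : Fin N → PMF α) {f : α → ℝ}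
    (hf : IsBdd f) :
    expect (indep p) (fun x => (expect (empirical x) f - expect (mixture p) f) ^ 2)
      ≤ expect (mixture p) (fun a => f a ^ 2) / N := by
  have expand (x : Fin N → α) : (expect (empirical x) f - expect (mixture p) f) ^ 2
      = ((∑ i, f (x i)) ^ 2 - 2 * (∑ i, expect (p i) f) * ∑ i, f (x i)
          + (∑ i, expect (p i) f) ^ 2) / N ^ 2 := by
    rw [expect_empirical _ hf, expect_mixture _ hf]
    ring
  simp only [expand]
  simp (disch := fun_prop) only [expect_div, expect_add, expect_sub, expect_const,
    expect_mul_left, expect_indep_sum, expect_indep_sum_sq, expect_mixture]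
  rw [div_div, ← pow_two]
  gcongr
  rw [Finset.sum_sub_distrib]
  linarith [Finset.sum_nonneg fun i (_ : i ∈ Finset.univ) => sq_nonneg (expect (p i) f)]

theorem abs_div_sub_div_le {a b s lo : ℝ} (hlo : 0 < lo) (hb : lo ≤ b) (hs : 0 < s) :
    |a / b - a / s| ≤ (a ^ 2 + (b - s) ^ 2 / 4) / (lo * s) := by
  have hb0 : 0 < b := hlo.trans_le hb
  have young : |a * (s - b)| ≤ a ^ 2 + (b - s) ^ 2 / 4 := by
    rw [abs_le]
    constructor <;> nlinarith [sq_nonneg (a + (s - b) / 2), sq_nonneg (a - (s - b) / 2)]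
  rw [div_sub_div _ _ hb0.ne' hs.ne', mul_comm b a, ← mul_sub, abs_div,
    abs_of_pos (mul_pos hb0 hs)]
  gcongr

theorem expect_sub_mul_sq_le (μ : PMF α) {u h : α → ℝ} {c hi : ℝ} (hu : ∀ a, u a ∈ Set.Icc 0 (h a))
    (hh : ∀ a, h a ≤ hi) (hc : expect μ u = c * expect μ h) :
    expect μ (fun a => (u a - c * h a) ^ 2) ≤ hi * expect μ h / 4 := by
  have h_mem (a : α) : h a ∈ Set.Icc 0 hi := ⟨(hu a).1.trans (hu a).2, hh a⟩
  have bh : IsBdd h := .of_mem_Icc h_mem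
  have bu : IsBdd u := .of_mem_Icc fun a => ⟨(hu a).1, (hu a).2.trans (hh a)⟩
  calc expect μ (fun a => (u a - c * h a) ^ 2)
      ≤ expect μ fun a => hi * ((1 - 2 * c) * u a + c ^ 2 * h a) := by
        refine expect_mono μ (by fun_prop) (by fun_prop) fun a => ?_
        -- `u ^ 2 ≤ h u` gives `(u - c h) ^ 2 ≤ h ((1 - 2 c) u + c ^ 2 h)`, and then `h ≤ hi`.
        obtain ⟨hu0, huh⟩ := hu a
        have factor_nonneg : 0 ≤ (1 - 2 * c) * u a + c ^ 2 * h a := by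
          nlinarith [mul_nonneg hu0 (sq_nonneg (1 - c)),
            mul_nonneg (sq_nonneg c) (sub_nonneg.2 huh)]
        nlinarith [mul_le_mul_of_nonneg_right (hh a) factor_nonneg,
          mul_nonneg hu0 (sub_nonneg.2 huh)]
    _ = hi * expect μ h * (c * (1 - c)) := by
        rw [expect_mul_left, expect_add _ (by fun_prop) (by fun_prop), expect_mul_left,
          expect_mul_left, hc]
        ring
    _ ≤ hi * expect μ h / 4 := by
        have mean := expect_mem_Icc μ h_mem
        have : 0 ≤ hi * expect μ h := mul_nonneg (mean.1.trans mean.2) mean.1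
        nlinarith [mul_nonneg this (sq_nonneg (c - 1 / 2))]

theorem abs_expect_indep_ratio_le [NeZero N] (p : Fin N → PMF α) {g h : α → ℝ} {lo : ℝ}
    (hlo : 0 < lo) (hg : IsBdd g) (hh : IsBdd h) (h_ge : ∀ a, lo ≤ h a)
    (mean_g : expect (mixture p) g = 0) :
    |expect (indep p) fun x => expect (empirical x) g / expect (empirical x) h|
      ≤ (expect (mixture p) (fun a => g a ^ 2) + expect (mixture p) (fun a => h a ^ 2) / 4)
        / (N * (lo * expect (mixture p) h)) := by
  set m := mixture p with m_def
  set s := expect m h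
  have le_expect (μ : PMF α) : lo ≤ expect μ h := by
    simpa only [expect_const] using expect_mono μ (.const lo) hh h_ge
  have s_pos : 0 < s := hlo.trans_le (le_expect m)
  have ratio_bdd : IsBdd fun x : Fin N → α => expect (empirical x) g / expect (empirical x) h :=
    .div (by fun_prop) hlo fun x => le_expect _
  have linear_term : expect (indep p) (fun x => expect (empirical x) g / s) = 0 := by
    rw [expect_div, expect_indep_empirical _ hg, mean_g, zero_div]
  have var_g := expect_indep_empirical_sub_sq_le p hg
  simp only [← m_def, mean_g, sub_zero] at var_g
  have var_h := expect_indep_empirical_sub_sq_le p hh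
  calc |expect (indep p) fun x => expect (empirical x) g / expect (empirical x) h|
      = |expect (indep p) fun x => expect (empirical x) g / expect (empirical x) h
          - expect (empirical x) g / s| := by
        rw [expect_sub _ ratio_bdd (by fun_prop), linear_term, sub_zero]
    _ ≤ expect (indep p) fun x =>
          (expect (empirical x) g ^ 2 + (expect (empirical x) h - s) ^ 2 / 4) / (lo * s) :=
        abs_expect_le_expect _ (by fun_prop) fun x => abs_div_sub_div_le hlo (le_expect _) s_pos
    _ ≤ (expect m (fun a => g a ^ 2) / N + expect m (fun a => h a ^ 2) / N / 4) / (lo * s) := by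
        rw [expect_div, expect_add _ (by fun_prop) (by fun_prop), expect_div]
        gcongr
    _ = _ := by
        field_simp

theorem abs_expect_indep_ratio_sub_le [NeZero N] (p : Fin N → PMF α) {u h : α → ℝ} {lo hi : ℝ}
    (hlo : 0 < lo) (hu : ∀ a, u a ∈ Set.Icc 0 (h a)) (hh : ∀ a, h a ∈ Set.Icc lo hi) :
    |expect (indep p) (fun x => expect (empirical x) u / expect (empirical x) h)
        - expect (mixture p) u / expect (mixture p) h| ≤ hi / lo / (2 * N) := by
  have bh : IsBdd h := .of_mem_Icc hh
  have bu : IsBdd u := .of_mem_Icc fun a => ⟨(hu a).1, (hu a).2.trans (hh a).2⟩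
  set s := expect (mixture p) h
  set c := expect (mixture p) u / s
  have expect_pos (μ : PMF α) : 0 < expect μ h := hlo.trans_le (expect_mem_Icc μ hh).1
  have s_pos : 0 < s := expect_pos _
  have hc : expect (mixture p) u = c * s := (div_mul_cancel₀ _ s_pos.ne').symm
  set g : α → ℝ := fun a => u a - c * h a
  have expect_g (μ : PMF α) : expect μ g = expect μ u - c * expect μ h := by
    rw [expect_sub _ (by fun_prop) (by fun_prop), expect_mul_left]
  have ratio_eq (x : Fin N → α) : expect (empirical x) u / expect (empirical x) h
      = expect (empirical x) g / expect (empirical x) h + c := by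
    rw [expect_g, sub_div, mul_div_cancel_right₀ _ (expect_pos _).ne', sub_add_cancel]
  have ratio_bdd : IsBdd fun x : Fin N → α => expect (empirical x) g / expect (empirical x) h :=
    .div (by fun_prop) hlo fun x => (expect_mem_Icc _ hh).1
  simp only [ratio_eq]
  rw [expect_add _ ratio_bdd (by fun_prop), expect_const, add_sub_cancel_right]
  calc |expect (indep p) fun x => expect (empirical x) g / expect (empirical x) h|
      ≤ _ := abs_expect_indep_ratio_le p hlo (by fun_prop) bh (fun a => (hh a).1)
        (by rw [expect_g, hc, sub_self])
    _ ≤ (hi * s / 4 + hi * s / 4) / (N * (lo * s)) := by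
        gcongr
        · exact expect_sub_mul_sq_le _ hu (fun a => (hh a).2) hc
        · exact expect_sq_le _ fun a => ⟨hlo.le.trans (hh a).1, (hh a).2⟩
    _ = hi / lo / (2 * N) := by
        field_simp
        ring

end Samples

/-! ## The Feynman–Kac semigroup -/

section Semigroup

variable {S : ℕ → Type u} (π : ∀ t, Prefix S t → PMF (S (t + 1))) {V : ∀ t, Prefix S t → ℝ≥0}
  {t T : ℕ}

theorem rollout_self (x : Prefix S t) : rollout π le_rfl x = PMF.pure x :=
  Nat.leRecOn_self _

theorem rollout_succ (h : t ≤ T) (h' : t ≤ T + 1) (x : Prefix S t) :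
    rollout π h' x = (rollout π h x).bind (naiveKernel π T) :=
  Nat.leRecOn_succ (C := fun k => PMF (Prefix S k)) h _

theorem rollout_eq_naiveKernel_bind (h : t + 1 ≤ T) (x : Prefix S t) :
    rollout π (Nat.le_of_succ_le h) x = (naiveKernel π t x).bind (rollout π h) := by
  induction T, h using Nat.le_induction with
  | base =>
    have rollout_eq_pure : rollout π (le_refl (t + 1)) = PMF.pure := funext (rollout_self π)
    rw [rollout_succ π le_rfl, rollout_self, PMF.pure_bind, rollout_eq_pure, PMF.bind_pure]
  | succ T h ih =>
    rw [rollout_succ π (Nat.le_of_succ_le h), ih, PMF.bind_bind]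
    congr 1
    funext y
    rw [rollout_succ π h]

theorem init_eq_of_mem_support_naiveKernel {x : Prefix S t} {y : Prefix S (t + 1)}
    (hy : y ∈ (naiveKernel π t x).support) : y.init = x := by
  obtain ⟨s, -, rfl⟩ := (PMF.mem_support_map_iff _ _ _).1 hy
  rfl

/-- Reward models for which the Feynman–Kac flow up to time `T` is well defined: positive values and
bounded potentials, which make all the normalizing constants positive and finite. -/
structure IsAdmissible (V : ∀ t, Prefix S t → ℝ≥0) (T : ℕ) : Prop where
  pos : ∀ t ≤ T, ∀ x : Prefix S t, 0 < V t x
  isBdd_potential : ∀ t ≤ T, IsBdd fun x : Prefix S t => (potential V t x : ℝ)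

/-- The unnormalized Feynman–Kac semigroup: the mean of `G_t ⋯ G_T f` over the continuations of a
prefix of length `t` by the base model. The product telescopes, because `G_k` is a ratio of
consecutive values, so only `G_t`, `V_t` and `V_T` appear. -/
def fkSemigroup (V : ∀ t, Prefix S t → ℝ≥0) (h : t ≤ T) (f : Prefix S T → ℝ) (x : Prefix S t) : ℝ :=
  potential V t x * (expect (rollout π h x) (fun y => V T y * f y) / V t x)

/-- The integral of `f` against the image of the law `η` at time `t` under the normalized
Feynman–Kac maps of the steps `t + 1, …, T + 1`. -/
def fkTerminalMean (V : ∀ t, Prefix S t → ℝ≥0) (h : t ≤ T) (f : Prefix S T → ℝ)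
    (η : PMF (Prefix S t)) : ℝ :=
  expect η (fkSemigroup π V h f) / expect η (fkSemigroup π V h 1)

theorem RatioBound.isAdmissible {L : ℝ} (hratio : RatioBound V T L)
    (hpos : ∀ t ≤ T, ∀ x : Prefix S t, 0 < V t x) : IsAdmissible V T where
  pos := hpos
  isBdd_potential
    | 0, _ => .const _
    | t + 1, h => .of_mem_Icc (a := 0) (b := L) fun x =>
      ⟨NNReal.coe_nonneg _, (le_max_right _ _).trans (hratio t h x)⟩

namespace IsAdmissible

theorem potential_pos (H : IsAdmissible V T) : ∀ {t : ℕ}, t ≤ T → ∀ x : Prefix S t,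
    0 < potential V t x
  | 0, _, _ => one_pos
  | t + 1, h, x => div_pos (H.pos _ h x) (H.pos t (Nat.le_of_succ_le h) x.init)

theorem isBdd_value (H : IsAdmissible V T) : ∀ {t : ℕ}, t ≤ T →
    IsBdd fun x : Prefix S t => (V t x : ℝ)
  | 0, _ => ⟨|V 0 Prefix.nil|, fun _ => le_rfl⟩
  | t + 1, h => by
    have value_eq (x : Prefix S (t + 1)) :
        (V (t + 1) x : ℝ) = potential V (t + 1) x * V t x.init := by
      rw [← NNReal.coe_mul, potential,
        div_mul_cancel₀ _ (H.pos t (Nat.le_of_succ_le h) x.init).ne']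
    simp only [value_eq]
    exact (H.isBdd_potential _ h).mul ((H.isBdd_value (Nat.le_of_succ_le h)).comp _)

theorem fkSemigroup_self (H : IsAdmissible V T) (f : Prefix S T → ℝ) :
    fkSemigroup π V le_rfl f = fun x => potential V T x * f x := by
  funext x
  rw [fkSemigroup, rollout_self, expect_pure,
    mul_div_cancel_left₀ _ (NNReal.coe_pos.2 (H.pos T le_rfl x)).ne']

theorem fkSemigroup_eq_potential_mul_expect (H : IsAdmissible V T) {f : Prefix S T → ℝ}
    (hf : IsBdd f) (h : t + 1 ≤ T) (x : Prefix S t) :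
    fkSemigroup π V (Nat.le_of_succ_le h) f x
      = potential V t x * expect (naiveKernel π t x) (fkSemigroup π V h f) := by
  have value_bdd := H.isBdd_value le_rfl
  rw [fkSemigroup, rollout_eq_naiveKernel_bind π h, expect_bind _ _ (by fun_prop), ← expect_div]
  congr 1
  refine expect_congr fun y hy => ?_
  have value_ne_zero : (V (t + 1) y : ℝ) ≠ 0 := (NNReal.coe_pos.2 (H.pos _ h y)).ne'
  rw [fkSemigroup, potential, init_eq_of_mem_support_naiveKernel π hy, NNReal.coe_div]
  field_simp

theorem isBdd_fkSemigroup (H : IsAdmissible V T) {f : Prefix S T → ℝ} (hf : IsBdd f)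
    (h : t ≤ T) : IsBdd (fkSemigroup π V h f) := by
  induction h using Nat.decreasingInduction with
  | self =>
    rw [H.fkSemigroup_self]
    exact (H.isBdd_potential T le_rfl).mul hf
  | of_succ t h ih =>
    simpa only [← H.fkSemigroup_eq_potential_mul_expect π hf h]
      using (H.isBdd_potential t h.le).mul (ih.expect (naiveKernel π t))

theorem fkSemigroup_one_pos (H : IsAdmissible V T) (h : t ≤ T) (x : Prefix S t) :
    0 < fkSemigroup π V h 1 x := by
  refine mul_pos (H.potential_pos h x) (div_pos ?_ (H.pos t h x))
  simpa using expect_pos _ (H.isBdd_value le_rfl) fun y => H.pos T le_rfl y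

variable {f : Prefix S T → ℝ}

theorem fkSemigroup_mem_Icc (H : IsAdmissible V T) (hf : ∀ y, f y ∈ Set.Icc 0 1) (h : t ≤ T)
    (x : Prefix S t) : fkSemigroup π V h f x ∈ Set.Icc 0 (fkSemigroup π V h 1 x) := by
  have value_bdd := H.isBdd_value le_rfl
  have hf_bdd : IsBdd f := .of_mem_Icc hf
  have reward_mem (y : Prefix S T) : V T y * f y ∈ Set.Icc 0 (V T y * (1 : ℝ)) :=
    ⟨mul_nonneg (NNReal.coe_nonneg _) (hf y).1, by gcongr; exact (hf y).2⟩
  have mean_nonneg : 0 ≤ expect (rollout π h x) fun y => V T y * f y := by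
    simpa only [expect_const] using
      expect_mono _ (.const 0) (by fun_prop) fun y => (reward_mem y).1
  refine ⟨by rw [fkSemigroup]; positivity, ?_⟩
  simp only [fkSemigroup, Pi.one_apply]
  gcongr
  exact expect_mono _ (by fun_prop) (by fun_prop) fun y => (reward_mem y).2

theorem fkTerminalMean_mem_Icc (H : IsAdmissible V T) (hf : ∀ y, f y ∈ Set.Icc 0 1) (h : t ≤ T)
    (η : PMF (Prefix S t)) : fkTerminalMean π V h f η ∈ Set.Icc 0 1 :=
  expect_div_expect_mem_Icc η (H.isBdd_fkSemigroup π (.const 1) h) (H.fkSemigroup_one_pos π h)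
    (H.fkSemigroup_mem_Icc π hf h)

theorem expect_fkMap_fkSemigroup (H : IsAdmissible V T) (hf : IsBdd f) (h : t + 1 ≤ T)
    (η : PMF (Prefix S t)) :
    expect (fkMap π V t η) (fkSemigroup π V h f)
      = expect η (fkSemigroup π V (Nat.le_of_succ_le h) f)
        / expect η fun x => (potential V t x : ℝ) := by
  have ht := Nat.le_of_succ_le h
  rw [fkMap, expect_bind _ _ (H.isBdd_fkSemigroup π hf h),
    expect_reweight _ (H.potential_pos ht) (H.isBdd_potential t ht)]
  simp only [← H.fkSemigroup_eq_potential_mul_expect π hf h]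

theorem fkTerminalMean_fkMap (H : IsAdmissible V T) (hf : IsBdd f) (h : t + 1 ≤ T)
    (η : PMF (Prefix S t)) :
    fkTerminalMean π V h f (fkMap π V t η) = fkTerminalMean π V (Nat.le_of_succ_le h) f η := by
  have ht := Nat.le_of_succ_le h
  rw [fkTerminalMean, H.expect_fkMap_fkSemigroup π hf,
    H.expect_fkMap_fkSemigroup π (f := 1) (.const 1), div_div_div_cancel_right₀, fkTerminalMean]
  exact (expect_pos η (H.isBdd_potential t ht) (H.potential_pos ht)).ne'

theorem expect_fkTerminalMap (H : IsAdmissible V T) (f : Prefix S T → ℝ) (η : PMF (Prefix S T)) :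
    expect (fkTerminalMap V T η) f = fkTerminalMean π V le_rfl f η := by
  rw [fkTerminalMap, expect_reweight _ (H.potential_pos le_rfl) (H.isBdd_potential T le_rfl),
    fkTerminalMean]
  simp only [H.fkSemigroup_self π, Pi.one_apply, mul_one]

theorem fkTerminalMean_nil (H : IsAdmissible V T) (f : Prefix S T → ℝ) :
    fkTerminalMean π V (Nat.zero_le T) f (PMF.pure Prefix.nil) = expect (target π V T) f := by
  have value_ne_zero : (V 0 (Prefix.nil : Prefix S 0) : ℝ) ≠ 0 :=
    (NNReal.coe_pos.2 (H.pos 0 (Nat.zero_le T) _)).ne'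
  rw [target, expect_reweight _ (H.pos T le_rfl) (H.isBdd_value le_rfl), fkTerminalMean,
    expect_pure, expect_pure, fkSemigroup, fkSemigroup, potential, NNReal.coe_one, one_mul,
    one_mul, div_div_div_cancel_right₀ value_ne_zero]
  simp only [Pi.one_apply, mul_one]

theorem fkTerminalMean_fkFlow (H : IsAdmissible V T) (hf : IsBdd f) :
    ∀ {t : ℕ} (h : t ≤ T), fkTerminalMean π V h f (fkFlow π V t) = expect (target π V T) f
  | 0, _ => H.fkTerminalMean_nil π f
  | _ + 1, h => (H.fkTerminalMean_fkMap π hf h _).trans (H.fkTerminalMean_fkFlow hf _)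

theorem fkTerminal_eq_target (H : IsAdmissible V T) : fkTerminal π V T = target π V T :=
  eq_of_forall_expect_eq fun f hf => by
    rw [fkTerminal, H.expect_fkTerminalMap π, H.fkTerminalMean_fkFlow π (.of_mem_Icc hf)]

end IsAdmissible

end Semigroup

/-! ## The bias of the particle approximation -/

section Bias

variable {S : ℕ → Type u} {π : ∀ t, Prefix S t → PMF (S (t + 1))} {V : ∀ t, Prefix S t → ℝ≥0}
  {t T N : ℕ} [NeZero N] {lo hi : ℝ} {f : Prefix S T → ℝ}
  {K : ∀ t, PMF (Prefix S t) → Prefix S t → PMF (Prefix S (t + 1))}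
  {K' : PMF (Prefix S T) → Prefix S T → PMF (Prefix S T)}

namespace IsAdmissible

theorem abs_expect_particleLaw_succ_sub_le (H : IsAdmissible V T) (hK : IsMcKean π V T K K')
    (hf : ∀ y, f y ∈ Set.Icc 0 1) (h : t + 1 ≤ T) (hlo : 0 < lo)
    (hQ : ∀ x, fkSemigroup π V h 1 x ∈ Set.Icc lo hi) :
    |expect (particleLaw K N (t + 1)) (fun x => fkTerminalMean π V h f (empirical x))
        - expect (particleLaw K N t)
          (fun x => fkTerminalMean π V (Nat.le_of_succ_le h) f (empirical x))|
      ≤ hi / lo / (2 * N) := by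
  have mean_bdd (k : ℕ) (hk : k ≤ T) :
      IsBdd fun x : Fin N → Prefix S k => fkTerminalMean π V hk f (empirical x) :=
    .of_mem_Icc fun x => H.fkTerminalMean_mem_Icc π hf hk _
  rw [particleLaw, expect_bind _ _ (mean_bdd _ h),
    ← expect_sub _ ((mean_bdd _ h).expect _) (mean_bdd _ _)]
  refine abs_expect_le _ fun x => ?_
  rw [← H.fkTerminalMean_fkMap π (.of_mem_Icc hf) h, ← hK.1 t h, empirical_bind]
  exact abs_expect_indep_ratio_sub_le _ hlo (H.fkSemigroup_mem_Icc π hf h) hQ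

theorem abs_expect_particleLaw_sub_le (H : IsAdmissible V T) (hK : IsMcKean π V T K K')
    (hf : ∀ y, f y ∈ Set.Icc 0 1) (hlo : 0 < lo)
    (hQ : ∀ t (h : t + 1 ≤ T) x, fkSemigroup π V h 1 x ∈ Set.Icc lo hi) : ∀ {t : ℕ} (h : t ≤ T),
    |expect (particleLaw K N t) (fun x => fkTerminalMean π V h f (empirical x))
        - expect (target π V T) f| ≤ t * (hi / lo / (2 * N))
  | 0, h => by
    have empirical_nil : empirical (fun _ : Fin N => (Prefix.nil : Prefix S 0))
        = PMF.pure Prefix.nil := PMF.map_const _ _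
    rw [particleLaw, expect_pure, empirical_nil, H.fkTerminalMean_nil]
    simp
  | t + 1, h => by
    have last_step := H.abs_expect_particleLaw_succ_sub_le (N := N) hK hf h hlo (hQ t h)
    have earlier_steps := H.abs_expect_particleLaw_sub_le hK hf hlo hQ (Nat.le_of_succ_le h)
    refine (abs_sub_le _ _ _).trans ((add_le_add last_step earlier_steps).trans_eq ?_)
    push_cast
    ring

theorem expect_outputLaw (H : IsAdmissible V T) (hK : IsMcKean π V T K K') (hf : IsBdd f) :
    expect (outputLaw K K' N) f
      = expect (particleLaw K N T) fun x => fkTerminalMean π V le_rfl f (empirical x) := by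
  rw [outputLaw, expect_bind _ _ hf, expect_bind _ _ (by fun_prop)]
  simp only [expect_indep_empirical _ hf, ← empirical_bind, hK.2, H.expect_fkTerminalMap π]

theorem tvDist_outputLaw_target_le (H : IsAdmissible V T) (hK : IsMcKean π V T K K') (hlo : 0 < lo)
    (hQ : ∀ t (h : t + 1 ≤ T) x, fkSemigroup π V h 1 x ∈ Set.Icc lo hi) :
    tvDist (outputLaw K K' N) (target π V T) ≤ T * (hi / lo / (2 * N)) :=
  tvDist_le fun f hf => by
    rw [H.expect_outputLaw hK (.of_mem_Icc hf)]
    exact H.abs_expect_particleLaw_sub_le hK hf hlo hQ le_rfl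

end IsAdmissible

theorem div_mem_Icc_inv_of_max_le {a b c : ℝ} (ha : 0 < a) (hb : 0 < b)
    (h : max (a / b) (b / a) ≤ c) : a / b ∈ Set.Icc c⁻¹ c := by
  obtain ⟨hab, hba⟩ := max_le_iff.1 h
  refine ⟨?_, hab⟩
  rw [← inv_div]
  exact inv_anti₀ (div_pos hb ha) hba

theorem fkSemigroup_one_mem_Icc {L ε : ℝ} (hpos : ∀ t ≤ T, ∀ x : Prefix S t, 0 < V t x)
    (hratio : RatioBound V T L) (hbellman : GlobalBellmanBound π V T ε) (h : t + 1 ≤ T)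
    (x : Prefix S (t + 1)) :
    fkSemigroup π V h 1 x ∈ Set.Icc (L * (1 + ε))⁻¹ (L * (1 + ε)) := by
  have H := hratio.isAdmissible hpos
  set E := expect (rollout π h x) fun y => (V T y : ℝ) with E_def
  have E_pos : 0 < E := expect_pos _ (H.isBdd_value le_rfl) (hpos T le_rfl)
  have V_pos : (0 : ℝ) < V (t + 1) x := hpos _ h x
  have V_init_pos : (0 : ℝ) < V t x.init := hpos t (Nat.le_of_succ_le h) x.init
  have potential_mem : (V (t + 1) x : ℝ) / V t x.init ∈ Set.Icc L⁻¹ L :=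
    div_mem_Icc_inv_of_max_le V_pos V_init_pos ((max_comm _ _).trans_le (hratio t h x))
  have bellman_mem : E / V (t + 1) x ∈ Set.Icc (1 + ε)⁻¹ (1 + ε) :=
    div_mem_Icc_inv_of_max_le E_pos V_pos
      ((max_comm _ _).trans_le (hbellman (t + 1) (Nat.le_add_left 1 t) h x))
  have L_pos : 0 < L := (div_pos V_pos V_init_pos).trans_le potential_mem.2
  have ε_pos : 0 < 1 + ε := (div_pos E_pos V_pos).trans_le bellman_mem.2
  simp only [fkSemigroup, potential, NNReal.coe_div, Pi.one_apply, mul_one, ← E_def, mul_inv]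
  exact ⟨mul_le_mul potential_mem.1 bellman_mem.1 (by positivity) (by positivity),
    mul_le_mul potential_mem.2 bellman_mem.2 (by positivity) L_pos.le⟩

theorem one_le_mul_one_add {L ε : ℝ} (hpos : ∀ t ≤ T, ∀ x : Prefix S t, 0 < V t x)
    (hratio : RatioBound V T L) (hbellman : GlobalBellmanBound π V T ε) (hT : 0 < T) :
    1 ≤ L * (1 + ε) := by
  obtain ⟨x, -⟩ := (naiveKernel π 0 Prefix.nil).support_nonempty
  have Q_mem := fkSemigroup_one_mem_Icc hpos hratio hbellman hT x
  have bound_pos := ((hratio.isAdmissible hpos).fkSemigroup_one_pos π hT x).trans_le Q_mem.2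
  by_contra! bound_lt
  linarith [Q_mem.1.trans Q_mem.2, (one_lt_inv₀ bound_pos).2 bound_lt]

theorem tvDist_outputLaw_target_le {L ε : ℝ} (hpos : ∀ t ≤ T, ∀ x : Prefix S t, 0 < V t x)
    (hratio : RatioBound V T L) (hbellman : GlobalBellmanBound π V T ε) (hT : 0 < T)
    (hK : IsMcKean π V T K K') :
    tvDist (outputLaw K K' N) (target π V T) ≤ (L * (1 + ε)) ^ 2 * T / (2 * N) := by
  have bound_pos : 0 < L * (1 + ε) :=
    one_pos.trans_le (one_le_mul_one_add hpos hratio hbellman hT)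
  refine ((hratio.isAdmissible hpos).tvDist_outputLaw_target_le hK (inv_pos.2 bound_pos)
    fun t => fkSemigroup_one_mem_Icc hpos hratio hbellman).trans_eq ?_
  rw [div_inv_eq_mul]
  ring

end Bias

/-! ## Law of the result and running time of a randomized computation -/

namespace Timed

variable {α : Type u} {β : Type v}

theorem output_ret (a : α) : (ret a).output = PMF.pure a := PMF.pure_map _ _

theorem output_calc (k : ℕ) (a : α) : (Timed.calc k a).output = PMF.pure a := PMF.pure_map _ _

theorem output_draw (p : PMF α) : (draw p).output = p := by
  rw [output, draw, PMF.map_comp]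
  exact PMF.map_id p

theorem output_bind (x : Timed α) (f : α → Timed β) :
    (x.bind f).output = x.output.bind fun a => (f a).output := by
  have map_fst_bind (p : PMF (α × ℕ)) (g : α → PMF (β × ℕ)) :
      (p.bind fun q => (g q.1).map fun r : β × ℕ => (r.1, q.2 + r.2)).map Prod.fst
        = (p.map Prod.fst).bind fun a => (g a).map Prod.fst := by
    simp only [PMF.map_bind, PMF.bind_map, PMF.map_comp]
    rfl
  exact map_fst_bind x f

theorem output_forEach : ∀ {N : ℕ} (c : Fin N → Timed α),
    (forEach c).output = indep fun i => (c i).output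
  | 0, _ => output_ret _
  | N + 1, c => by
    simp only [forEach, output_bind, output_forEach, output_ret, indep_succ]
    rfl

theorem runsWithin_ret (a : α) : (ret a).RunsWithin 0 := fun p hp => by
  rw [ret, PMF.support_pure, Set.mem_singleton_iff] at hp
  simp [hp]

theorem runsWithin_calc (k : ℕ) (a : α) : (Timed.calc k a).RunsWithin k := fun p hp => by
  rw [Timed.calc, PMF.support_pure, Set.mem_singleton_iff] at hp
  simp [hp]

theorem runsWithin_draw (q : PMF α) : (draw q).RunsWithin 1 := fun p hp => by
  obtain ⟨a, -, rfl⟩ := (PMF.mem_support_map_iff _ _ _).1 hp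
  simp

theorem RunsWithin.mono {x : Timed α} {A B : ℝ} (hx : x.RunsWithin A) (h : A ≤ B) :
    x.RunsWithin B := fun p hp => (hx p hp).trans h

theorem RunsWithin.bind {x : Timed α} {f : α → Timed β} {A B : ℝ} (hx : x.RunsWithin A)
    (hf : ∀ a, (f a).RunsWithin B) : (x.bind f).RunsWithin (A + B) := fun p hp => by
  obtain ⟨q, hq, hp⟩ := (PMF.mem_support_bind_iff (p := x) _ _).1 hp
  obtain ⟨r, hr, rfl⟩ := (PMF.mem_support_map_iff _ _ _).1 hp
  push_cast
  exact add_le_add (hx q hq) (hf _ r hr)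

theorem runsWithin_forEach {B : ℝ} : ∀ {N : ℕ} {c : Fin N → Timed α},
    (∀ i, (c i).RunsWithin B) → (forEach c).RunsWithin (N * B)
  | 0, _, _ => (runsWithin_ret _).mono (by simp)
  | N + 1, c, h =>
    ((h 0).bind fun _ => (runsWithin_forEach fun i => h i.succ).bind fun _ =>
      runsWithin_ret _).mono (le_of_eq (by push_cast; ring))

end Timed

/-! ## The naive-proposal SMC algorithm -/

section Algorithm

variable {S : ℕ → Type u} {N : ℕ} [NeZero N]

theorem expect_categorical {w : Fin N → ℝ≥0} (hw : ∀ i, 0 < w i) (f : Fin N → ℝ) :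
    expect (categorical w) f = (∑ i, (w i : ℝ) * f i) / ∑ i, (w i : ℝ) := by
  rw [categorical, expect_normalizeOr]
  · simp [tsum_fintype]
  · rw [Ne, ENNReal.tsum_eq_zero, not_forall]
    exact ⟨0, by simpa using (hw 0).ne'⟩
  · simp [tsum_fintype]

theorem map_categorical {α : Type u} {w : α → ℝ≥0} (hw : ∀ a, 0 < w a)
    (hb : IsBdd fun a => (w a : ℝ)) (x : Fin N → α) :
    (categorical fun i => w (x i)).map x = reweight (empirical x) w :=
  eq_of_forall_expect_eq fun f hf => by
    have hf_bdd : IsBdd f := .of_mem_Icc hf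
    rw [expect_map _ _ hf_bdd, expect_categorical fun i => hw (x i), expect_reweight _ hw hb,
      expect_empirical _ (hb.mul hf_bdd), expect_empirical _ hb,
      div_div_div_cancel_right₀ (Nat.cast_ne_zero.2 (NeZero.ne N))]

section Steps

variable (V : ∀ t, Prefix S t → ℝ≥0) (π : ∀ t, Prefix S t → PMF (S (t + 1)))

theorem output_weightStep : ∀ (t : ℕ) (x : Prefix S t),
    (weightStep V t x).output = PMF.pure (potential V t x)
  | 0, _ => Timed.output_ret _
  | t + 1, x => by
    simp only [weightStep, Timed.output_bind, Timed.output_calc, PMF.pure_bind]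
    rfl

theorem runsWithin_weightStep : ∀ (t : ℕ) (x : Prefix S t), (weightStep V t x).RunsWithin 3
  | 0, _ => (Timed.runsWithin_ret _).mono (by norm_num)
  | t + 1, x => ((Timed.runsWithin_calc _ _).bind fun _ => (Timed.runsWithin_calc _ _).bind fun _ =>
      Timed.runsWithin_calc _ _).mono (by norm_num)

theorem output_resample (w : Fin N → ℝ≥0) :
    (resample w).output = indep fun _ => categorical w := by
  simp only [resample, Timed.output_bind, Timed.output_calc, PMF.pure_bind, Timed.output_forEach,
    Timed.output_draw]

theorem runsWithin_resample (w : Fin N → ℝ≥0) : (resample w).RunsWithin (4 * N) :=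
  ((Timed.runsWithin_calc _ _).bind fun _ => Timed.runsWithin_forEach fun _ =>
    Timed.runsWithin_draw _).mono (le_of_eq (by push_cast; ring))

theorem output_extend (t : ℕ) (x : Prefix S t) : (extend π t x).output = naiveKernel π t x := by
  simp only [extend, Timed.output_bind, Timed.output_draw, Timed.output_calc]
  exact PMF.bind_pure_comp _ _

theorem runsWithin_extend (t : ℕ) (x : Prefix S t) : (extend π t x).RunsWithin 2 :=
  ((Timed.runsWithin_draw _).bind fun _ => Timed.runsWithin_calc _ _).mono (by norm_num)

theorem runsWithin_smcRound : ∀ (t : ℕ) (x : Fin N → Prefix S t),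
    (smcRound π V t x).RunsWithin (9 * N)
  | 0, _ => by
    rw [smcRound]
    exact (Timed.runsWithin_forEach fun _ => runsWithin_extend _ _ _).mono
      (by linarith [N.cast_nonneg (α := ℝ)])
  | _ + 1, _ => by
    rw [smcRound]
    exact ((Timed.runsWithin_forEach fun _ => runsWithin_weightStep _ _ _).bind fun w =>
      (runsWithin_resample w).bind fun _ => Timed.runsWithin_forEach fun _ =>
        runsWithin_extend _ _ _).mono (le_of_eq (by ring))

theorem runsWithin_smcRounds : ∀ t : ℕ, (smcRounds π V N t).RunsWithin (9 * N * t)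
  | 0 => (Timed.runsWithin_ret _).mono (by simp)
  | t + 1 => ((runsWithin_smcRounds t).bind (runsWithin_smcRound V π t)).mono
      (le_of_eq (by push_cast; ring))

theorem runsWithin_naiveSMC (T : ℕ) : (naiveSMC π V T N).RunsWithin (9 * N * (T + 1)) := by
  have one_le_N : (1 : ℝ) ≤ N := by exact_mod_cast Nat.one_le_iff_ne_zero.2 (NeZero.ne N)
  refine ((runsWithin_smcRounds V π T).bind fun _ =>
    (Timed.runsWithin_forEach fun _ => runsWithin_weightStep _ _ _).bind fun w =>
      (runsWithin_resample w).bind fun _ =>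
        (Timed.runsWithin_forEach fun _ => Timed.runsWithin_calc _ _).bind fun _ =>
          (Timed.runsWithin_draw _).bind fun _ => Timed.runsWithin_ret _).mono ?_
  push_cast
  linarith

theorem isMcKean_naive (T : ℕ) :
    IsMcKean π V T (fun t η _ => fkMap π V t η) (fun η _ => fkTerminalMap V T η) :=
  ⟨fun _ _ _ => PMF.bind_const _ _, fun _ => PMF.bind_const _ _⟩

end Steps

variable {π : ∀ t, Prefix S t → PMF (S (t + 1))} {V : ∀ t, Prefix S t → ℝ≥0} {t T : ℕ}

namespace IsAdmissible

theorem map_categorical_potential (H : IsAdmissible V T) (h : t ≤ T) (x : Fin N → Prefix S t) :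
    (categorical fun i => potential V t (x i)).map x = reweight (empirical x) (potential V t) :=
  map_categorical (H.potential_pos h) (H.isBdd_potential t h) x

theorem output_smcRound (H : IsAdmissible V T) : ∀ {t : ℕ}, t ≤ T → ∀ x : Fin N → Prefix S t,
    (smcRound π V t x).output = indep fun _ => fkMap π V t (empirical x)
  | 0, _, x => by
    rw [smcRound, Timed.output_forEach]
    congr 1
    funext i
    have kernel_const : naiveKernel π 0 = fun _ => naiveKernel π 0 (x i) := rfl
    rw [output_extend, fkMap, kernel_const, PMF.bind_const]
  | t + 1, h, x => by
    simp only [smcRound, Timed.output_bind, Timed.output_forEach, output_weightStep, indep_pure,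
      PMF.pure_bind, output_resample, output_extend]
    rw [indep_bind_indep (fun _ => _) fun _ a => naiveKernel π (t + 1) (x a)]
    simp only [fkMap, ← H.map_categorical_potential h, PMF.bind_map]
    rfl

theorem output_smcRounds (H : IsAdmissible V T) : ∀ {t : ℕ}, t ≤ T →
    (smcRounds π V N t).output = particleLaw (fun t η _ => fkMap π V t η) N t
  | 0, _ => Timed.output_ret _
  | t + 1, h => by
    have ht := Nat.le_of_succ_le h
    simp only [smcRounds, Timed.output_bind, H.output_smcRounds ht, H.output_smcRound ht,
      particleLaw]

theorem indep_categorical_bind_pure (H : IsAdmissible V T) (x : Fin N → Prefix S T) :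
    (indep fun _ : Fin N => categorical fun i => potential V T (x i)).bind
        (fun A : Fin N → Fin N => PMF.pure fun i : Fin N => x (A i))
      = indep fun _ : Fin N => fkTerminalMap V T (empirical x) := by
  rw [fkTerminalMap, ← H.map_categorical_potential le_rfl, ← PMF.bind_pure_comp,
    ← indep_bind_indep]
  simp only [Function.comp_apply, indep_pure]

theorem output_naiveSMC (H : IsAdmissible V T) :
    (naiveSMC π V T N).output
      = outputLaw (fun t η _ => fkMap π V t η) (fun η _ => fkTerminalMap V T η) N := by
  simp only [naiveSMC, Timed.output_bind, Timed.output_forEach, output_weightStep, indep_pure,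
    PMF.pure_bind, output_resample, Timed.output_draw, Timed.output_calc, Timed.output_ret,
    H.output_smcRounds le_rfl]
  rw [outputLaw, PMF.bind_bind]
  congr 1
  funext x
  rw [← H.indep_categorical_bind_pure, PMF.bind_bind]
  simp only [PMF.pure_bind]
  rfl

end IsAdmissible

end Algorithm

/-! ## Number of particles -/

section Particles

variable {S : ℕ → Type u} {π : ∀ t, Prefix S t → PMF (S (t + 1))} {V : ∀ t, Prefix S t → ℝ≥0}
  {T k : ℕ} {L ε δ : ℝ}

theorem exists_neZero_le_natCast_le {A : ℝ} (hA : 1 / 2 ≤ A) :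
    ∃ (N : ℕ) (_ : NeZero N), A ≤ N ∧ (N : ℝ) ≤ 3 * A :=
  ⟨⌈A⌉₊, ⟨(Nat.ceil_pos.2 (by linarith)).ne'⟩, Nat.le_ceil A, by
    linarith [Nat.ceil_lt_add_one (show 0 ≤ A by linarith)]⟩

theorem tvDist_outputLaw_target_le_of_le (hpos : ∀ t ≤ T, ∀ x : Prefix S t, 0 < V t x)
    (hratio : RatioBound V T L) (hbellman : GlobalBellmanBound π V T ε) (hT : 0 < T)
    (hk : 2 ≤ k) (hδ : 0 < δ) {N : ℕ} [NeZero N]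
    (hN : L ^ k * T * (1 + ε) ^ k / (2 * δ) ≤ N)
    {K : ∀ t, PMF (Prefix S t) → Prefix S t → PMF (Prefix S (t + 1))}
    {K' : PMF (Prefix S T) → Prefix S T → PMF (Prefix S T)} (hK : IsMcKean π V T K K') :
    tvDist (outputLaw K K' N) (target π V T) ≤ δ := by
  have one_le : 1 ≤ L * (1 + ε) := one_le_mul_one_add hpos hratio hbellman hT
  have N_pos : (0 : ℝ) < N := Nat.cast_pos.2 (NeZero.pos N)
  refine (tvDist_outputLaw_target_le hpos hratio hbellman hT hK).trans ?_
  rw [div_le_iff₀ (by positivity)] at hN ⊢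
  calc (L * (1 + ε)) ^ 2 * T ≤ (L * (1 + ε)) ^ k * T := by gcongr
    _ = L ^ k * T * (1 + ε) ^ k := by rw [mul_pow, mul_right_comm]
    _ ≤ N * (2 * δ) := hN
    _ = δ * (2 * N) := by ring

theorem half_le_pow_mul_pow_div (hpos : ∀ t ≤ T, ∀ x : Prefix S t, 0 < V t x)
    (hratio : RatioBound V T L) (hbellman : GlobalBellmanBound π V T ε) (hT : 0 < T)
    (hδ : 0 < δ) (hδ_le : δ ≤ 1) : 1 / 2 ≤ L ^ k * T * (1 + ε) ^ k / (2 * δ) := by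
  have one_le_pow : 1 ≤ (L * (1 + ε)) ^ k :=
    one_le_pow₀ (one_le_mul_one_add hpos hratio hbellman hT)
  have one_le_T : (1 : ℝ) ≤ T := Nat.one_le_cast.2 hT
  rw [le_div_iff₀ (by positivity)]
  calc 1 / 2 * (2 * δ) = δ := by ring
    _ ≤ 1 := hδ_le
    _ ≤ (L * (1 + ε)) ^ k * T := one_le_mul_of_one_le_of_one_le one_le_pow one_le_T
    _ = L ^ k * T * (1 + ε) ^ k := by rw [mul_pow, mul_right_comm]

end Particles

end

end SMC

theorem mainTheorem11_general {S : ℕ → Type*} {π : ∀ t, SMC.Prefix S t → PMF (S (t + 1))}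
    {V : ∀ t, SMC.Prefix S t → ℝ≥0} {T k : ℕ} {L ε δ : ℝ}
    (hpos : ∀ t ≤ T, ∀ x : SMC.Prefix S t, 0 < V t x) (hratio : SMC.RatioBound V T L)
    (hbellman : SMC.GlobalBellmanBound π V T ε) (hT : 0 < T) (hk : 2 ≤ k) (hδ : 0 < δ)
    (hδ_le : δ ≤ 1) :
    SMC.fkTerminal π V T = SMC.target π V T ∧
      (∀ (N : ℕ) [NeZero N], L ^ k * T * (1 + ε) ^ k / (2 * δ) ≤ N →
        (∀ K K', SMC.IsMcKean π V T K K' →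
          SMC.tvDist (SMC.outputLaw K K' N) (SMC.target π V T) ≤ δ) ∧
        SMC.tvDist (SMC.naiveSMC π V T N).output (SMC.target π V T) ≤ δ) ∧
      ∃ (N : ℕ) (_ : NeZero N), L ^ k * T * (1 + ε) ^ k / (2 * δ) ≤ N ∧
        SMC.tvDist (SMC.naiveSMC π V T N).output (SMC.target π V T) ≤ δ ∧
        (SMC.naiveSMC π V T N).RunsWithin (27 * (L ^ k * (1 + ε) ^ k * T ^ 2 / δ)) := by
  have H : SMC.IsAdmissible V T := hratio.isAdmissible hpos
  have error_le (N : ℕ) [NeZero N] (hN : L ^ k * T * (1 + ε) ^ k / (2 * δ) ≤ N) K K'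
      (hK : SMC.IsMcKean π V T K K') :
      SMC.tvDist (SMC.outputLaw K K' N) (SMC.target π V T) ≤ δ :=
    SMC.tvDist_outputLaw_target_le_of_le hpos hratio hbellman hT hk hδ hN hK
  have naive_error_le (N : ℕ) [NeZero N] (hN : L ^ k * T * (1 + ε) ^ k / (2 * δ) ≤ N) :
      SMC.tvDist (SMC.naiveSMC π V T N).output (SMC.target π V T) ≤ δ := by
    rw [H.output_naiveSMC]
    exact error_le N hN _ _ (SMC.isMcKean_naive V π T)
  refine ⟨H.fkTerminal_eq_target π, fun N _ hN => ⟨error_le N hN, naive_error_le N hN⟩, ?_⟩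
  obtain ⟨N, _, hN, N_le⟩ := SMC.exists_neZero_le_natCast_le
    (SMC.half_le_pow_mul_pow_div hpos hratio hbellman hT hδ hδ_le (k := k))
  have one_le_T : (1 : ℝ) ≤ T := Nat.one_le_cast.2 hT
  refine ⟨N, ‹_›, hN, naive_error_le N hN, (SMC.runsWithin_naiveSMC V π T).mono ?_⟩
  calc 9 * N * ((T : ℝ) + 1)
      ≤ 9 * N * (T + T) := by gcongr
    _ ≤ 9 * (3 * (L ^ k * T * (1 + ε) ^ k / (2 * δ))) * (T + T) := by gcongr
    _ = 27 * (L ^ k * (1 + ε) ^ k * T ^ 2 / δ) := by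
      field_simp
      ring

theorem mainTheorem11 :
    ∃ C : ℝ, 0 < C ∧
      ∀ (S : ℕ → Type*)
        (πref : S 0 → ∀ t, SMC.Prefix S t → PMF (S (t + 1)))
        (V : S 0 → ∀ t, SMC.Prefix S t → ℝ≥0)
        (s₀ : S 0) (T : ℕ) (L ε δ : ℝ),
        2 ≤ T → 0 < δ → δ < 1 → 0 < L →
        (∀ t ≤ T, ∀ x : SMC.Prefix S t, 0 < V s₀ t x) →
        SMC.RatioBound (V s₀) T L →
        SMC.GlobalBellmanBound (πref s₀) (V s₀) T ε →
        -- the terminal law of the Feynman-Kac flow is the target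
        SMC.fkTerminal (πref s₀) (V s₀) T = SMC.target (πref s₀) (V s₀) T ∧
        -- number of particles
        (∀ (N : ℕ) [NeZero N], L ^ 6 * T * (1 + ε) ^ 6 / (2 * δ) ≤ N →
          (∀ K K', SMC.IsMcKean (πref s₀) (V s₀) T K K' →
            SMC.tvDist (SMC.outputLaw K K' N) (SMC.target (πref s₀) (V s₀) T) ≤ δ) ∧
          SMC.tvDist (SMC.naiveSMC (πref s₀) (V s₀) T N).output
            (SMC.target (πref s₀) (V s₀) T) ≤ δ) ∧
        -- total time
        ∃ (N : ℕ) (_ : NeZero N), L ^ 6 * T * (1 + ε) ^ 6 / (2 * δ) ≤ N ∧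
          SMC.tvDist (SMC.naiveSMC (πref s₀) (V s₀) T N).output
            (SMC.target (πref s₀) (V s₀) T) ≤ δ ∧
          (SMC.naiveSMC (πref s₀) (V s₀) T N).RunsWithin
            (C * (L ^ 6 * (1 + ε) ^ 6 * T ^ 2 / δ)) :=
  ⟨27, by norm_num, fun _ _ _ _ _ _ _ _ hT hδ hδ1 _ hpos hratio hbellman =>
    mainTheorem11_general hpos hratio hbellman (by omega) (by norm_num) hδ hδ1.le⟩
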